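/- **Setting.** Let $n\ge 1$. An RBM with $n$ visible and $N$ hidden units has the law $\Pr[X=x,H=h]\propto\exp(\langle x,Wh\rangle+\langle b^{(1)},x\rangle+\langle b^{(2)},h\rangle)$ on $\{\pm1\}^n\times\{\pm1\}^N$. Write $\lambda_2(W)=\max_j\sum_i|W_{ij}|$ for the maximum $\ell_1$-norm into a hidden unit, and $\|w\|_1=\sum_j|\tanh W_{nj}|$. Visible unit $n$ is the label $Y$, the others are the input $X\in\{\pm1\}^{n-1}$. For $S\subseteq[n]$ with $n\in S$, an RBM with $|S|^2+1$ hidden units *realises the parity on $S$ at scale $C>0$* if the visible units outside $S$ are isolated and have no external field, and its visible marginal is $P(x)\propto e^{f(x)}$ for some $f$ with $\sup_{x\in\{\pm1\}^n}|f(x)/C-\prod_{i\in S}x_i|\le e^{-n}$. A statistical query (SQ) algorithm with tolerance $\tau_0$ and $q$ queries, possibly randomised, adaptively asks at most $q$ queries $(g,\tau)$ with $g:\{\pm1\}^{n-1}\times\{\pm1\}\to[-1,1]$ and $\tau\ge\tau_0$, receives from an oracle values within $\tau$ of $\mathbb E[g(X,Y)]$, and then outputs a hypothesis $h:\{\pm1\}^{n-1}\to\{\pm1\}$.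 Let $R=(R_S)$ be a family of RBMs indexed by a set $\mathcal S$ of subsets $S\ni n$ of $[n]$. The algorithm *learns with error less than $1/4$ and success probability $\alpha$* over $\mathcal S$ if for every $S\in\mathcal S$ and every valid oracle for the visible law of $R_S$, with probability at least $\alpha$ its output satisfies $\Pr[h(X)\ne Y]<1/4$ or $\Pr[h(X)\ne\prod_{i\in S\setminus\{n\}}X_i]<1/4$. For a polynomial $p$ and a real $\lambda_2\le p(n)$, call the family *$(p,\lambda_2)$-admissible* over $\mathcal S$ if for every $S\in\mathcal S$ the RBM $R_S$ realises the parity on $S$ at some scale $0<C_S\le p(n)$, with $\lambda_2(W_S)\le\lambda_2$ and $\|w_S\|_1\le p(n)$. **Theorem.** 1. There is a polynomial $p$ such that for every $n\ge1$ and every $S\subseteq[n]$ with $n\in S$ there is an RBM with $|S|^2+1$ hidden units that realises the parity on $S$ at a scale $1\le C\le p(n)$, with $\lambda_2(W)\le p(n)$ and $\|w\|_1\le p(n)$. 2. For every polynomial $p$ there is $\epsilon>0$ such that for every $\alpha>0$ and all sufficiently large $n$: for every $\lambda_2$ and every $(p,\lambda_2)$-admissible family over $\{S\subseteq[n]:n\in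 S\}$ (so that the targets are the class $\mathcal F$ of all parities on $[n-1]$), no SQ algorithm with tolerance $n^{-\lambda_2^{\epsilon}}$ and $n^{\lambda_2^{\epsilon}}$ queries learns with error less than $1/4$ and success probability $\alpha$. 3. For every polynomial $p$ and every $\delta>0$ there is $\epsilon>0$ such that for every $\alpha>0$, all sufficiently large $n$ and all $k$ with $n^\delta\le k\le n-n^\delta$: for every $\lambda_2$ and every $(p,\lambda_2)$-admissible family over $\{S\subseteq[n]:n\in S,\ |S|=k\}$, no SQ algorithm with tolerance $n^{-\lambda_2^{\epsilon}}$ and $n^{\lambda_2^{\epsilon}}$ queries learns with error less than $1/4$ and success probability $\alpha$. -/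

import Mathlib

/-- A restricted Boltzmann machine with visible units `V` and hidden units `H`: a weight matrix
`W` and the external fields of the visible and of the hidden units. Spins take values in
`{-1, 1}`, represented by `ℤˣ`. -/
structure RBM (V H : Type) where
  W : Matrix V H ℝ
  bV : V → ℝ
  bH : H → ℝ

namespace RBM

variable {V H : Type} [Fintype V] [Fintype H]

/-- The unnormalised weight `exp(⟨x, W h⟩ + ⟨b⁽¹⁾, x⟩ + ⟨b⁽²⁾, h⟩)` of a joint configuration. -/
noncomputable def jointWeight (R : RBM V H) (x : V → ℤˣ) (h : H → ℤˣ) : ℝ :=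
  Real.exp (∑ i, ∑ j, ((x i : ℤ) : ℝ) * R.W i j * ((h j : ℤ) : ℝ)
    + ∑ i, R.bV i * ((x i : ℤ) : ℝ) + ∑ j, R.bH j * ((h j : ℤ) : ℝ))

/-- The marginal distribution of the visible units (its probability mass function). -/
noncomputable def visibleLaw [DecidableEq V] [DecidableEq H] (R : RBM V H) (x : V → ℤˣ) : ℝ :=
  (∑ h : H → ℤˣ, R.jointWeight x h) /
    ∑ x' : V → ℤˣ, ∑ h : H → ℤˣ, R.jointWeight x' h

/-- `λ₂`: the maximum over the hidden units of the `ℓ₁`-norm of the weights into that unit. -/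
noncomputable def lambdaTwo (R : RBM V H) : ℝ := ⨆ j, ∑ i, |R.W i j|

/-- `‖w‖₁`, where `w j = tanh (W i j)` are the top-layer weights of the two-layer network which
predicts the visible unit `i` from the other visible units. -/
noncomputable def topNorm (R : RBM V H) (i : V) : ℝ := ∑ j, |Real.tanh (R.W i j)|

end RBM

/-- The parity `χ_S(x) = ∏_{i ∈ S} x_i`. -/
def parity {ι : Type} (S : Finset ι) (x : ι → ℤˣ) : ℤˣ := ∏ i ∈ S, x i

/-- With `n = m + 1` visible units, the last of which is the label: `R` is an RBM that realises
the parity on `S` at scale `C` up to accuracy `exp (-n)`. The units outside `S` are isolated and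
have no external field, and the visible law is proportional to `exp f` with
`|f / C - χ_S| ≤ exp (-n)` on the whole cube. -/
structure ApproximatesParity {m : ℕ} {H : Type} [Fintype H] [DecidableEq H]
    (R : RBM (Fin (m + 1)) H) (S : Finset (Fin (m + 1))) (C : ℝ) : Prop where
  isolated : ∀ i, i ∉ S → (∀ j, R.W i j = 0) ∧ R.bV i = 0
  approx : ∃ f : (Fin (m + 1) → ℤˣ) → ℝ,
    (∀ x, R.visibleLaw x = Real.exp (f x) / ∑ x', Real.exp (f x')) ∧
    ∀ x, |f x / C - ((parity S x : ℤ) : ℝ)| ≤ Real.exp (-((m + 1 : ℕ) : ℝ))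

/-- A choice of RBM for each set of visible units; the one for `S` has `|S|² + 1` hidden units. -/
abbrev RBMFamily (m : ℕ) : Type :=
  (S : Finset (Fin (m + 1))) → RBM (Fin (m + 1)) (Fin (S.card ^ 2 + 1))

/-- For every possible `S`, the RBM chosen for `S` realises the parity on `S` with a scale `C`
and a norm `‖w‖₁` (for the label unit) at most `B`, and with `λ₂` at most `L`, where `L ≤ B`. -/
def AdmissibleFamily {m : ℕ} (𝒮 : Set (Finset (Fin (m + 1)))) (R : RBMFamily m) (B L : ℝ) : Prop :=
  L ≤ B ∧ ∀ S ∈ 𝒮, (R S).lambdaTwo ≤ L ∧ (R S).topNorm (Fin.last m) ≤ B ∧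
    ∃ C : ℝ, 0 < C ∧ C ≤ B ∧ ApproximatesParity (R S) S C

/-- A statistical query: a function of an example `(x, y)` with values in `[-1, 1]`. -/
abbrev SQuery (m : ℕ) : Type := (Fin m → ℤˣ) → ℤˣ → Set.Icc (-1 : ℝ) 1

/-- The expectation of `g(X, Y)`, where `D` is the law of `(X, Y)` and the label `Y` is the last
coordinate. -/
noncomputable def expect {m : ℕ} (D : (Fin (m + 1) → ℤˣ) → ℝ) (g : SQuery m) : ℝ :=
  ∑ z : Fin (m + 1) → ℤˣ, D z * (g (Fin.init z) (z (Fin.last m)) : ℝ)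

/-- `O` is a statistical query oracle for `D`: its answer to a query `g` with tolerance `τ` is
within `τ` of the expectation of `g`. -/
def IsSQOracle {m : ℕ} (D : (Fin (m + 1) → ℤˣ) → ℝ) (O : SQuery m → ℝ → ℝ) : Prop :=
  ∀ (g : SQuery m) (τ : ℝ), 0 ≤ τ → |expect D g - O g τ| ≤ τ

/-- A deterministic adaptive algorithm that asks at most `q` statistical queries, each of
tolerance at least `τ₀`, and then outputs a hypothesis. The next step may depend arbitrarily on
the answers received so far. -/
inductive SQAlgorithm (m : ℕ) (τ₀ : ℝ) : ℕ → Type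
  | output {q : ℕ} (h : (Fin m → ℤˣ) → ℤˣ) : SQAlgorithm m τ₀ q
  | query {q : ℕ} (g : SQuery m) (τ : ℝ) (hτ : τ₀ ≤ τ) (next : ℝ → SQAlgorithm m τ₀ q) :
      SQAlgorithm m τ₀ (q + 1)

/-- The hypothesis that the algorithm outputs when its queries are answered by `O`. -/
def SQAlgorithm.run {m : ℕ} {τ₀ : ℝ} (O : SQuery m → ℝ → ℝ) :
    {q : ℕ} → SQAlgorithm m τ₀ q → (Fin m → ℤˣ) → ℤˣ
  | _, .output h => h
  | _, .query g τ _ next => (next (O g τ)).run O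

/-- `Pr[h(X) ≠ Y]`. -/
noncomputable def labelError {m : ℕ} (D : (Fin (m + 1) → ℤˣ) → ℝ) (h : (Fin m → ℤˣ) → ℤˣ) : ℝ :=
  ∑ z : Fin (m + 1) → ℤˣ, if h (Fin.init z) ≠ z (Fin.last m) then D z else 0

/-- `Pr[h(X) ≠ c(X)]`. -/
noncomputable def conceptError {m : ℕ} (D : (Fin (m + 1) → ℤˣ) → ℝ)
    (c h : (Fin m → ℤˣ) → ℤˣ) : ℝ :=
  ∑ z : Fin (m + 1) → ℤˣ, if h (Fin.init z) ≠ c (Fin.init z) then D z else 0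

/-- The member of the class of parities on `[n - 1]` that belongs to `S`: the parity of the inputs
that lie in `S`, that is, on `S \ {n}`. -/
def targetParity {m : ℕ} (S : Finset (Fin (m + 1))) : (Fin m → ℤˣ) → ℤˣ :=
  parity (Finset.univ.filter fun i : Fin m => i.castSucc ∈ S)

/-- Some (possibly randomised) algorithm with at most `q` statistical queries of tolerance at least
`τ₀` learns with error less than `err` when the unknown set is any member of `𝒮`: for every `S ∈ 𝒮`
and every valid oracle for the visible law of `R S`, with probability at least `α` over the
algorithm's coins, its output has error less than `err`. The error may be measured against the
label or against the target parity; either is accepted. -/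
def SQLearnable {m : ℕ} (𝒮 : Set (Finset (Fin (m + 1)))) (R : RBMFamily m)
    (τ₀ : ℝ) (q : ℕ) (err α : ℝ) : Prop :=
  ∃ (Ω : Type) (_ : MeasurableSpace Ω) (μ : MeasureTheory.Measure Ω)
    (_ : MeasureTheory.IsProbabilityMeasure μ) (A : Ω → SQAlgorithm m τ₀ q),
    ∀ S ∈ 𝒮, ∀ O : SQuery m → ℝ → ℝ, IsSQOracle (R S).visibleLaw O →
      ∃ G : Set Ω, MeasurableSet G ∧ α ≤ μ.real G ∧ ∀ ω ∈ G,
        labelError (R S).visibleLaw ((A ω).run O) < err ∨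
        conceptError (R S).visibleLaw (targetParity S) ((A ω).run O) < err

/-- The sets of visible units that contain the label unit. -/
def labelledSets (m : ℕ) : Set (Finset (Fin (m + 1))) := {S | Fin.last m ∈ S}

/-- The sets of `k` visible units that contain the label unit. -/
def labelledSetsOfCard (m k : ℕ) : Set (Finset (Fin (m + 1))) := {S | Fin.last m ∈ S ∧ S.card = k}

open Finset

/-! Hardness. If the exponent of the law is `C * χ_S` up to a small error, then `exp (C * χ) = cosh
C * (1 + tanh C * χ)` shows that the law is nearly uniform with density `1 + tanh C * χ_S`. A query
`g` then sees `S` only through the Walsh coefficient of `g` at `S`. By Parseval at most `4 / τ₀ ^ 2`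
sets have a coefficient of size at least `τ₀ / 2`; for all others the answer for the uniform law is
valid. Hence outside `q * (4 / τ₀ ^ 2)` sets a deterministic algorithm outputs one fixed hypothesis,
and, by Parseval again, that hypothesis correlates by `1 / 4` with at most 16 parities. Averaging
over the coins gives `SQLearnable.mul_card_le`. Since `L` is polynomially bounded, a small `ε` makes
this bound subexponential in `n ^ δ`, while the classes have at least `2 ^ (n ^ δ - 1)` members.

Existence. Summing out the hidden units leaves the exponent `∑ log (2 cosh θ_j)` plus the visible
fields, and `log (2 cosh θ)` is close to `|θ|`. Let `k = |S|`, and let `t` be the number of negative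
spins in `S`, so that their sum is `s = k - 2 * t` and the parity is `(-1) ^ t`. Kinks at all the
values `k - 2 * u`, with weights alternating between `C` and `3 * C`, add up to `C * (-1) ^ t + C *
s ^ 2` plus an affine function of `t`. Antiferromagnetic pair units cancel the square exactly, and a
visible field cancels the linear term. This takes `k + 1` threshold units and `k ^ 2 - k` pair
units. -/

theorem parity_cast_eq_prod {ι : Type} (S : Finset ι) (z : ι → ℤˣ) :
    ((parity S z : ℤ) : ℝ) = ∏ i ∈ S, ((z i : ℤ) : ℝ) := by
  simp [parity, Units.coe_prod]

theorem units_cast_mul_self (u : ℤˣ) : ((u : ℤ) : ℝ) * ((u : ℤ) : ℝ) = 1 := by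
  rcases Int.units_eq_one_or u with rfl | rfl <;> simp

theorem abs_units_cast (u : ℤˣ) : |((u : ℤ) : ℝ)| = 1 := by
  rcases Int.units_eq_one_or u with rfl | rfl <;> simp

theorem parity_update_neg {ι : Type} [DecidableEq ι] {S : Finset ι} {i : ι} (hi : i ∈ S)
    (z : ι → ℤˣ) : parity S (Function.update z i (-z i)) = -parity S z := by
  unfold parity
  rw [Finset.prod_update_of_mem hi, ← Finset.mul_prod_erase S z hi, Finset.sdiff_singleton_eq_erase,
    neg_mul]

/-- The sum factors as `∏ (1 + z i * z' i)`, and a coordinate where the points differ contributes a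
factor 0. -/
theorem sum_parity_mul_parity {ι : Type} [Fintype ι] (z z' : ι → ℤˣ) :
    ∑ S : Finset ι, ((parity S z : ℤ) : ℝ) * ((parity S z' : ℤ) : ℝ) =
      if z = z' then 2 ^ Fintype.card ι else 0 := by
  have h : ∑ S : Finset ι, ((parity S z : ℤ) : ℝ) * ((parity S z' : ℤ) : ℝ) =
      ∏ i, (1 + ((z i : ℤ) : ℝ) * ((z' i : ℤ) : ℝ)) := by
    rw [Finset.prod_one_add, Finset.powerset_univ]
    exact Finset.sum_congr rfl fun S _ => by
      rw [parity_cast_eq_prod, parity_cast_eq_prod, Finset.prod_mul_distrib]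
  rw [h]
  split_ifs with hz
  · subst hz
    simp only [units_cast_mul_self]
    norm_num [Finset.prod_const, Finset.card_univ]
  · obtain ⟨i, hi⟩ := Function.ne_iff.1 hz
    refine Finset.prod_eq_zero (Finset.mem_univ i) ?_
    rcases Int.units_eq_one_or (z i) with h1 | h1 <;>
      rcases Int.units_eq_one_or (z' i) with h2 | h2 <;> simp_all

/-! ### Walsh coefficients and laws tilted by a parity -/

section Walsh

variable {ι : Type} [Fintype ι] [DecidableEq ι]

/-- The coefficient of `g` at the character `parity S`, with respect to the uniform law. -/
noncomputable def walshCoeff (g : (ι → ℤˣ) → ℝ) (S : Finset ι) : ℝ :=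
  (∑ z, g z * ((parity S z : ℤ) : ℝ)) / 2 ^ Fintype.card ι

theorem sum_walshCoeff_sq (g : (ι → ℤˣ) → ℝ) :
    ∑ S, walshCoeff g S ^ 2 = (∑ z, g z ^ 2) / 2 ^ Fintype.card ι := by
  have h2 : (2 : ℝ) ^ Fintype.card ι ≠ 0 := by positivity
  have h : ∑ S : Finset ι, (∑ z, g z * ((parity S z : ℤ) : ℝ)) ^ 2 =
      2 ^ Fintype.card ι * ∑ z, g z ^ 2 := by
    calc ∑ S : Finset ι, (∑ z, g z * ((parity S z : ℤ) : ℝ)) ^ 2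
        = ∑ S : Finset ι, ∑ z, ∑ z', g z * g z' *
            (((parity S z : ℤ) : ℝ) * ((parity S z' : ℤ) : ℝ)) := by
          refine Finset.sum_congr rfl fun S _ => ?_
          rw [sq, Finset.sum_mul_sum]
          exact Finset.sum_congr rfl fun z _ => Finset.sum_congr rfl fun z' _ => by ring
      _ = ∑ z, ∑ z', g z * g z' *
            ∑ S : Finset ι, ((parity S z : ℤ) : ℝ) * ((parity S z' : ℤ) : ℝ) := by
          rw [Finset.sum_comm]
          refine Finset.sum_congr rfl fun z _ => ?_
          rw [Finset.sum_comm]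
          exact Finset.sum_congr rfl fun z' _ => by rw [Finset.mul_sum]
      _ = 2 ^ Fintype.card ι * ∑ z, g z ^ 2 := by
          rw [Finset.mul_sum]
          refine Finset.sum_congr rfl fun z _ => ?_
          simp only [sum_parity_mul_parity, mul_ite, mul_zero, Finset.sum_ite_eq,
            Finset.mem_univ, if_true]
          ring
  simp only [walshCoeff, div_pow]
  rw [← Finset.sum_div, h]
  field_simp

/-- Chebyshev's inequality applied to Parseval's identity. It serves both for queries and for the
final hypothesis. -/
theorem card_walshCoeff_ge_mul_sq_le {g : (ι → ℤˣ) → ℝ} (hg : ∀ z, |g z| ≤ 1) {t : ℝ}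
    (ht : 0 ≤ t) : (#{S | t ≤ |walshCoeff g S|} : ℝ) * t ^ 2 ≤ 1 := by
  have hle : (∑ z, g z ^ 2) / 2 ^ Fintype.card ι ≤ 1 := by
    rw [div_le_one (by positivity)]
    calc ∑ z, g z ^ 2 ≤ ∑ _z : ι → ℤˣ, (1 : ℝ) :=
          Finset.sum_le_sum fun z _ => (sq_le_one_iff_abs_le_one _).2 (hg z)
      _ = 2 ^ Fintype.card ι := by simp
  rw [← sum_walshCoeff_sq] at hle
  calc (#{S | t ≤ |walshCoeff g S|} : ℝ) * t ^ 2
      = ∑ _S with t ≤ |walshCoeff g _S|, t ^ 2 := by rw [Finset.sum_const, nsmul_eq_mul]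
    _ ≤ ∑ S with t ≤ |walshCoeff g S|, walshCoeff g S ^ 2 := by
        refine Finset.sum_le_sum fun S hS => ?_
        rw [← sq_abs (walshCoeff g S)]
        exact pow_le_pow_left₀ ht (Finset.mem_filter.1 hS).2 2
    _ ≤ ∑ S, walshCoeff g S ^ 2 :=
        Finset.sum_le_sum_of_subset_of_nonneg (Finset.subset_univ _) fun _ _ _ => sq_nonneg _
    _ ≤ 1 := hle

/-- A function that changes sign with the spin `i` has mean zero. -/
theorem sum_eq_zero_of_flip {φ : (ι → ℤˣ) → ℝ} (i : ι)
    (h : ∀ z, φ (Function.update z i (-z i)) = -φ z) : ∑ z, φ z = 0 := by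
  have hinv : Function.Involutive fun z : ι → ℤˣ => Function.update z i (-z i) := by
    intro z
    simp
  have := Equiv.sum_comp hinv.toPerm φ
  simp only [Function.Involutive.coe_toPerm, h, Finset.sum_neg_distrib] at this
  linarith

theorem sum_parity_eq_zero {S : Finset ι} (hS : S.Nonempty) :
    ∑ z : ι → ℤˣ, ((parity S z : ℤ) : ℝ) = 0 := by
  obtain ⟨i, hi⟩ := hS
  refine sum_eq_zero_of_flip i fun z => ?_
  rw [parity_update_neg hi]
  simp

theorem walshCoeff_mul_parity_self (g : (ι → ℤˣ) → ℝ) (S : Finset ι) :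
    walshCoeff (fun z => g z * ((parity S z : ℤ) : ℝ)) S = walshCoeff g ∅ := by
  have h : ∀ z : ι → ℤˣ, parity ∅ z = 1 := fun _ => Finset.prod_empty
  simp [walshCoeff, mul_assoc, units_cast_mul_self, h]

theorem walshCoeff_mul_parity_empty (g : (ι → ℤˣ) → ℝ) (S : Finset ι) :
    walshCoeff (fun z => g z * ((parity S z : ℤ) : ℝ)) ∅ = walshCoeff g S := by
  simp [walshCoeff, parity]

/-- Up to an error `e` in total variation, `D` has density `1 + t * parity S` with respect to the
uniform law, for some `t ∈ [-1, 1]`. -/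
def IsParityTilt (D : (ι → ℤˣ) → ℝ) (S : Finset ι) (e : ℝ) : Prop :=
  ∑ z, D z = 1 ∧ ∃ t : ℝ, |t| ≤ 1 ∧ ∀ φ : (ι → ℤˣ) → ℝ, (∀ z, |φ z| ≤ 1) →
    |∑ z, D z * φ z - (walshCoeff φ ∅ + t * walshCoeff φ S)| ≤ e

theorem IsParityTilt.mono {D : (ι → ℤˣ) → ℝ} {S : Finset ι} {e e' : ℝ} (h : IsParityTilt D S e)
    (he : e ≤ e') : IsParityTilt D S e' :=
  ⟨h.1, h.2.imp fun _ ht => ⟨ht.1, fun φ hφ => (ht.2 φ hφ).trans he⟩⟩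

theorem exp_mul_units_cast (C : ℝ) (u : ℤˣ) :
    Real.exp (C * ((u : ℤ) : ℝ)) = Real.cosh C * (1 + Real.tanh C * ((u : ℤ) : ℝ)) := by
  have hc : Real.cosh C ≠ 0 := (Real.cosh_pos C).ne'
  have : Real.cosh C * (1 + Real.tanh C * ((u : ℤ) : ℝ)) =
      Real.cosh C + Real.sinh C * ((u : ℤ) : ℝ) := by
    rw [Real.tanh_eq_sinh_div_cosh]; field_simp
  rw [this]
  rcases Int.units_eq_one_or u with rfl | rfl
  · simp [Real.cosh_add_sinh]
  · simp [← sub_eq_add_neg, Real.cosh_sub_sinh]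

/-- `exp (C * χ)` normalises exactly to the density `1 + tanh C * χ`, because `χ` has mean zero. An
error `η` in the exponent costs a factor `exp η` in the weight and another in the normaliser. -/
theorem isParityTilt_of_abs_sub_le {S : Finset ι} (hS : S.Nonempty) {D f : (ι → ℤˣ) → ℝ}
    {C η : ℝ} (hD : ∀ z, D z = Real.exp (f z) / ∑ z', Real.exp (f z'))
    (hf : ∀ z, |f z - C * ((parity S z : ℤ) : ℝ)| ≤ η) :
    IsParityTilt D S (Real.exp (2 * η) - 1) := by
  set χ : (ι → ℤˣ) → ℝ := fun z => ((parity S z : ℤ) : ℝ) with hχ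
  have hcosh := Real.cosh_pos C
  have hN : (0 : ℝ) < 2 ^ Fintype.card ι := by positivity
  set Z := ∑ z, Real.exp (f z) with hZ
  set Z₀ : ℝ := 2 ^ Fintype.card ι * Real.cosh C with hZ₀
  have hZ₀pos : 0 < Z₀ := by positivity
  have hsum : ∑ z, Real.exp (C * χ z) = Z₀ := by
    simp only [hχ, exp_mul_units_cast]
    rw [← Finset.mul_sum, Finset.sum_add_distrib, ← Finset.mul_sum, sum_parity_eq_zero hS]
    simp [hZ₀, mul_comm]
  have hup : ∀ z, Real.exp (f z) ≤ Real.exp η * Real.exp (C * χ z) := fun z => by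
    rw [← Real.exp_add]
    exact Real.exp_le_exp.2 (by linarith [(abs_le.1 (hf z)).2])
  have hlo : ∀ z, Real.exp (C * χ z) ≤ Real.exp η * Real.exp (f z) := fun z => by
    rw [← Real.exp_add]
    exact Real.exp_le_exp.2 (by linarith [(abs_le.1 (hf z)).1])
  have hZup : Z ≤ Real.exp η * Z₀ := by
    rw [hZ, ← hsum, Finset.mul_sum]
    exact Finset.sum_le_sum fun z _ => hup z
  have hZlo : Z₀ ≤ Real.exp η * Z := by
    rw [hZ, ← hsum, Finset.mul_sum]
    exact Finset.sum_le_sum fun z _ => hlo z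
  have hZpos : 0 < Z := Finset.sum_pos (fun z _ => Real.exp_pos _) Finset.univ_nonempty
  set Q : (ι → ℤˣ) → ℝ := fun z => Real.exp (C * χ z) / Z₀ with hQ
  have hQ0 : ∀ z, 0 < Q z := fun z => by positivity
  have hQsum : ∑ z, Q z = 1 := by
    rw [hQ, ← Finset.sum_div, hsum, div_self hZ₀pos.ne']
  have hE : Real.exp (2 * η) = Real.exp η * Real.exp η := by rw [← Real.exp_add]; ring_nf
  have hDup : ∀ z, D z ≤ Real.exp (2 * η) * Q z := fun z => by
    rw [hD, hE, hQ, ← mul_div_assoc, div_le_div_iff₀ hZpos hZ₀pos]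
    calc Real.exp (f z) * Z₀ ≤ (Real.exp η * Real.exp (C * χ z)) * (Real.exp η * Z) :=
          mul_le_mul (hup z) hZlo hZ₀pos.le (by positivity)
      _ = _ := by ring
  have hDlo : ∀ z, Q z ≤ Real.exp (2 * η) * D z := fun z => by
    rw [hD, hE, hQ, ← mul_div_assoc, div_le_div_iff₀ hZ₀pos hZpos]
    calc Real.exp (C * χ z) * Z ≤ (Real.exp η * Real.exp (f z)) * (Real.exp η * Z₀) :=
          mul_le_mul (hlo z) hZup hZpos.le (by positivity)
      _ = _ := by ring
  have hDQ : ∀ z, |D z - Q z| ≤ (Real.exp (2 * η) - 1) * Q z := fun z => by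
    have h1 := hDup z
    have h2 := hDlo z
    have hEpos := Real.exp_pos (2 * η)
    rw [abs_le]
    refine ⟨?_, by linarith⟩
    -- With `E = exp (2 * η)`, the bound `D ≥ Q / E` gives `D ≥ (2 - E) * Q`, because `(E - 1) ^ 2 ≥
    -- 0`.
    have h3 : Real.exp (2 * η) * (Real.exp (2 * η) * D z) ≥ Real.exp (2 * η) * Q z :=
      mul_le_mul_of_nonneg_left h2 hEpos.le
    have h4 : 0 ≤ (Real.exp (2 * η) - 1) ^ 2 * Q z := mul_nonneg (sq_nonneg _) (hQ0 z).le
    by_contra hcon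
    push Not at hcon
    have h5 : D z < (2 - Real.exp (2 * η)) * Q z := by linarith
    have h6 := mul_lt_mul_of_pos_left h5 hEpos
    nlinarith
  refine ⟨?_, Real.tanh C, (Real.abs_tanh_lt_one C).le, fun φ hφ => ?_⟩
  · simp only [hD]
    rw [← Finset.sum_div, div_self hZpos.ne']
  · have hQφ : walshCoeff φ ∅ + Real.tanh C * walshCoeff φ S = ∑ z, Q z * φ z := by
      simp only [hQ, hχ, exp_mul_units_cast, walshCoeff, hZ₀]
      rw [← mul_div_assoc, ← add_div, Finset.mul_sum, ← Finset.sum_add_distrib, Finset.sum_div]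
      refine Finset.sum_congr rfl fun z _ => ?_
      simp only [parity, Finset.prod_empty, Units.val_one, Int.cast_one]
      field_simp
    rw [hQφ, ← Finset.sum_sub_distrib]
    calc |∑ z, (D z * φ z - Q z * φ z)| ≤ ∑ z, |D z * φ z - Q z * φ z| :=
          Finset.abs_sum_le_sum_abs _ _
      _ ≤ ∑ z, (Real.exp (2 * η) - 1) * Q z := by
          refine Finset.sum_le_sum fun z _ => ?_
          rw [← sub_mul, abs_mul]
          calc |D z - Q z| * |φ z| ≤ |D z - Q z| * 1 :=
                mul_le_mul_of_nonneg_left (hφ z) (abs_nonneg _)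
            _ ≤ _ := by rw [mul_one]; exact hDQ z
      _ = Real.exp (2 * η) - 1 := by rw [← Finset.mul_sum, hQsum, mul_one]

end Walsh

theorem ApproximatesParity.isParityTilt {m : ℕ} {H : Type} [Fintype H] [DecidableEq H]
    {R : RBM (Fin (m + 1)) H} {S : Finset (Fin (m + 1))} {C : ℝ} (hS : S.Nonempty) (hC : 0 < C)
    (h : ApproximatesParity R S C) :
    IsParityTilt R.visibleLaw S (Real.exp (2 * (C * Real.exp (-((m + 1 : ℕ) : ℝ)))) - 1) := by
  obtain ⟨f, hlaw, hf⟩ := h.approx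
  refine isParityTilt_of_abs_sub_le (C := C) hS hlaw fun z => ?_
  have : f z - C * ((parity S z : ℤ) : ℝ) = C * (f z / C - ((parity S z : ℤ) : ℝ)) := by
    field_simp
  rw [this, abs_mul, abs_of_pos hC]
  exact mul_le_mul_of_nonneg_left (hf z) hC.le

/-! ### The statistical query lower bound -/

/-- The product of the hypothesis and the label. -/
noncomputable def agreement {m : ℕ} (h : (Fin m → ℤˣ) → ℤˣ) (z : Fin (m + 1) → ℤˣ) : ℝ :=
  ((h (Fin.init z) : ℤ) : ℝ) * ((z (Fin.last m) : ℤ) : ℝ)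

theorem abs_agreement {m : ℕ} (h : (Fin m → ℤˣ) → ℤˣ) (z : Fin (m + 1) → ℤˣ) :
    |agreement h z| = 1 := by
  rw [agreement, abs_mul, abs_units_cast, abs_units_cast, one_mul]

theorem walshCoeff_agreement_empty {m : ℕ} (h : (Fin m → ℤˣ) → ℤˣ) :
    walshCoeff (agreement h) ∅ = 0 := by
  have : ∑ z, agreement h z = 0 := by
    refine sum_eq_zero_of_flip (Fin.last m) fun z => ?_
    simp [agreement]
  simp [walshCoeff, parity, this]

theorem parity_eq_targetParity_mul {m : ℕ} {S : Finset (Fin (m + 1))} (hS : Fin.last m ∈ S)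
    (z : Fin (m + 1) → ℤˣ) :
    parity S z = targetParity S (Fin.init z) * z (Fin.last m) := by
  have h : ∀ (T : Finset (Fin (m + 1))), parity T z = ∏ i, if i ∈ T then z i else 1 := by
    intro T
    rw [parity, Finset.prod_ite_mem, Finset.univ_inter]
  rw [h, Fin.prod_univ_castSucc, if_pos hS, targetParity, parity, Finset.prod_filter]
  rfl

theorem ite_ne_mul (u v : ℤˣ) (d : ℝ) :
    (if u ≠ v then d else 0) = (d - d * (((u : ℤ) : ℝ) * ((v : ℤ) : ℝ))) / 2 := by
  rcases Int.units_eq_one_or u with rfl | rfl <;> rcases Int.units_eq_one_or v with rfl | rfl <;>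
    simp [show (1 : ℤˣ) ≠ -1 by decide, show (-1 : ℤˣ) ≠ 1 by decide]

/-- A hypothesis of small error correlates with the parity. -/
theorem IsParityTilt.le_abs_walshCoeff_agreement {m : ℕ} {S : Finset (Fin (m + 1))}
    (hS : Fin.last m ∈ S) {D : (Fin (m + 1) → ℤˣ) → ℝ} {e : ℝ} (hD : IsParityTilt D S e)
    (he : e ≤ 1 / 4) {h : (Fin m → ℤˣ) → ℤˣ}
    (hh : labelError D h < 1 / 4 ∨ conceptError D (targetParity S) h < 1 / 4) :
    1 / 4 ≤ |walshCoeff (agreement h) S| := by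
  obtain ⟨hsum, t, ht, hφ⟩ := hD
  rcases hh with hh | hh
  · have h1 := hφ (agreement h) fun z => (abs_agreement h z).le
    rw [walshCoeff_agreement_empty, zero_add] at h1
    simp only [labelError, ite_ne_mul] at hh
    rw [← Finset.sum_div, Finset.sum_sub_distrib, hsum] at hh
    -- Error below `1 / 4` means that the mean of `agreement h` exceeds `1 / 2`. The tilt error
    -- costs at most `1 / 4` of this.
    have h2 : t * walshCoeff (agreement h) S ≤ |walshCoeff (agreement h) S| := by
      refine (le_abs_self _).trans ?_
      rw [abs_mul]
      exact mul_le_of_le_one_left (abs_nonneg _) ht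
    have h3 := (abs_le.1 h1).2
    simp only [agreement] at h2 h3 ⊢
    linarith
  -- Multiplying by `χ_S` removes the label and leaves hypothesis times target; it also swaps the
  -- coefficients at `∅` and `S`, so the unknown `t` now multiplies 0.
  · have h1 := hφ (fun z => agreement h z * ((parity S z : ℤ) : ℝ)) fun z => by
      rw [abs_mul, abs_agreement, abs_units_cast, one_mul]
    rw [walshCoeff_mul_parity_self, walshCoeff_mul_parity_empty, walshCoeff_agreement_empty,
      mul_zero, add_zero] at h1
    simp only [conceptError, ite_ne_mul] at hh
    rw [← Finset.sum_div, Finset.sum_sub_distrib, hsum] at hh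
    have h4 : ∀ z : Fin (m + 1) → ℤˣ, agreement h z * ((parity S z : ℤ) : ℝ) =
        ((h (Fin.init z) : ℤ) : ℝ) * ((targetParity S (Fin.init z) : ℤ) : ℝ) := fun z => by
      rw [parity_eq_targetParity_mul hS, agreement, Units.val_mul, Int.cast_mul]
      linear_combination ((h (Fin.init z) : ℤ) : ℝ) * ((targetParity S (Fin.init z) : ℤ) : ℝ) *
        units_cast_mul_self (z (Fin.last m))
    simp only [h4] at h1
    have h3 := (abs_le.1 h1).2
    have h2 := le_abs_self (walshCoeff (agreement h) S)
    linarith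

/-- A query as a function on the cube. -/
def SQuery.onCube {m : ℕ} (g : SQuery m) (z : Fin (m + 1) → ℤˣ) : ℝ :=
  g (Fin.init z) (z (Fin.last m))

/-- The oracle for `D` that gives the answer for the uniform law whenever this is admissible. -/
noncomputable def lazyOracle {m : ℕ} (D : (Fin (m + 1) → ℤˣ) → ℝ) (g : SQuery m) (τ : ℝ) : ℝ :=
  open Classical in
  if |expect D g - walshCoeff g.onCube ∅| ≤ τ then walshCoeff g.onCube ∅ else expect D g

theorem isSQOracle_lazyOracle {m : ℕ} (D : (Fin (m + 1) → ℤˣ) → ℝ) :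
    IsSQOracle D (lazyOracle D) := by
  intro g τ hτ
  unfold lazyOracle
  split_ifs with h
  · exact h
  · simpa using hτ

theorem IsParityTilt.abs_expect_sub_le {m : ℕ} {S : Finset (Fin (m + 1))}
    {D : (Fin (m + 1) → ℤˣ) → ℝ} {e : ℝ} (hD : IsParityTilt D S e) (g : SQuery m) :
    |expect D g - walshCoeff g.onCube ∅| ≤ |walshCoeff g.onCube S| + e := by
  obtain ⟨-, t, ht, hφ⟩ := hD
  have h1 := hφ g.onCube fun z => abs_le.2 (g _ _).2
  have h2 : |t * walshCoeff g.onCube S| ≤ |walshCoeff g.onCube S| := by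
    rw [abs_mul]
    exact mul_le_of_le_one_left (abs_nonneg _) ht
  have h3 : expect D g = ∑ z, D z * g.onCube z := rfl
  rw [h3, show ∑ z, D z * g.onCube z - walshCoeff g.onCube ∅ =
    (∑ z, D z * g.onCube z - (walshCoeff g.onCube ∅ + t * walshCoeff g.onCube S)) +
      t * walshCoeff g.onCube S by ring]
  exact (abs_add_le _ _).trans (by linarith)

/-- Each query distinguishes few of the laws from the uniform law, so for all but a few of them
the algorithm behaves as for the uniform law. -/
theorem exists_forall_run_lazyOracle_eq {m : ℕ} {τ₀ e : ℝ} (hτ₀ : 0 < τ₀) (he : e ≤ τ₀ / 2)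
    {𝒮 : Set (Finset (Fin (m + 1)))} {D : Finset (Fin (m + 1)) → (Fin (m + 1) → ℤˣ) → ℝ}
    (hD : ∀ S ∈ 𝒮, IsParityTilt (D S) S e) {q : ℕ} (A : SQAlgorithm m τ₀ q) :
    ∃ B : Finset (Finset (Fin (m + 1))), (#B : ℝ) ≤ q * (4 / τ₀ ^ 2) ∧
      ∀ S ∈ 𝒮, S ∉ B →
        A.run (lazyOracle (D S)) = A.run fun g _ => walshCoeff g.onCube ∅ := by
  induction A with
  | output h => exact ⟨∅, by simp only [Finset.card_empty, Nat.cast_zero]; positivity,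
      fun _ _ _ => rfl⟩
  | @query q g τ hτ next ih =>
    -- Only the branch that follows the answers for the uniform law matters, so the exceptional sets
    -- add up along one path of the tree.
    obtain ⟨B, hB, hrun⟩ := ih (walshCoeff g.onCube ∅)
    refine ⟨B ∪ ({S | τ₀ / 2 ≤ |walshCoeff g.onCube S|} : Finset _), ?_, fun S hS hSB => ?_⟩
    · have h1 := card_walshCoeff_ge_mul_sq_le (g := g.onCube) (fun z => abs_le.2 (g _ _).2)
        (half_pos hτ₀).le
      have h2 : (#{S | τ₀ / 2 ≤ |walshCoeff g.onCube S|} : ℝ) ≤ 4 / τ₀ ^ 2 := by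
        rw [le_div_iff₀ (by positivity)]
        linarith
      have h3 : (#(B ∪ ({S | τ₀ / 2 ≤ |walshCoeff g.onCube S|} : Finset _)) : ℝ) ≤
          #B + #{S | τ₀ / 2 ≤ |walshCoeff g.onCube S|} := by
        exact_mod_cast Finset.card_union_le _ _
      push_cast
      linarith
    · simp only [Finset.mem_union, Finset.mem_filter, Finset.mem_univ, true_and, not_or,
        not_le] at hSB
      have h1 := (hD S hS).abs_expect_sub_le g
      have h2 : lazyOracle (D S) g τ = walshCoeff g.onCube ∅ :=
        if_pos (by linarith [hSB.2])
      change (next (lazyOracle (D S) g τ)).run _ = (next (walshCoeff g.onCube ∅)).run _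
      rw [h2]
      exact hrun S hS hSB.1

/-- The statistical query bound: a learner can succeed only for a small class. -/
theorem SQLearnable.mul_card_le {m : ℕ} {τ₀ e α : ℝ} (hτ₀ : 0 < τ₀) (he : e ≤ τ₀ / 2)
    (he' : e ≤ 1 / 4) {𝒮 : Finset (Finset (Fin (m + 1)))} (h𝒮 : ∀ S ∈ 𝒮, Fin.last m ∈ S)
    {R : RBMFamily m} (hR : ∀ S ∈ 𝒮, IsParityTilt (R S).visibleLaw S e) {q : ℕ}
    (hL : SQLearnable (𝒮 : Set (Finset (Fin (m + 1)))) R τ₀ q (1 / 4) α) :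
    α * #𝒮 ≤ q * (4 / τ₀ ^ 2) + 16 := by
  obtain ⟨Ω, _, μ, _, A, hA⟩ := hL
  choose! G hGm hGα hG using fun S hS => hA S hS _ (isSQOracle_lazyOracle (R S).visibleLaw)
  set M : ℝ := q * (4 / τ₀ ^ 2) + 16
  have hpt : ∀ ω, ∑ S ∈ 𝒮, (G S).indicator (fun _ => (1 : ℝ)) ω ≤ M := by
    classical
    intro ω
    obtain ⟨B, hB, hrun⟩ := exists_forall_run_lazyOracle_eq hτ₀ he
      (𝒮 := (𝒮 : Set (Finset (Fin (m + 1))))) hR (A ω)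
    set h := (A ω).run fun g _ => walshCoeff g.onCube ∅ with hh
    have h16 := card_walshCoeff_ge_mul_sq_le (g := agreement h)
      (fun z => (abs_agreement h z).le) (show (0 : ℝ) ≤ 1 / 4 by norm_num)
    have hsub : {S ∈ 𝒮 | ω ∈ G S} ⊆
        B ∪ ({S | 1 / 4 ≤ |walshCoeff (agreement h) S|} : Finset _) := by
      intro S hS
      obtain ⟨hS, hω⟩ := Finset.mem_filter.1 hS
      by_cases hSB : S ∈ B
      · exact Finset.mem_union_left _ hSB
      · refine Finset.mem_union_right _ (Finset.mem_filter.2 ⟨Finset.mem_univ _, ?_⟩)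
        have := hG S hS ω hω
        rw [hrun S hS hSB] at this
        exact (hR S hS).le_abs_walshCoeff_agreement (h𝒮 S hS) he' this
    have hcard : (#{S ∈ 𝒮 | ω ∈ G S} : ℝ) ≤
        #B + #{S | 1 / 4 ≤ |walshCoeff (agreement h) S|} := by
      exact_mod_cast (Finset.card_le_card hsub).trans (Finset.card_union_le _ _)
    simp only [Set.indicator_apply]
    rw [Finset.sum_boole]
    linarith
  -- For every outcome of the coins at most `M` sets are learnt; integrate this over the coins.
  have hint : ∑ S ∈ 𝒮, μ.real (G S) ≤ M := by
    have hi : ∀ S ∈ 𝒮, MeasureTheory.Integrable ((G S).indicator fun _ => (1 : ℝ)) μ :=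
      fun S hS => (MeasureTheory.integrable_const 1).indicator (hGm S hS)
    calc ∑ S ∈ 𝒮, μ.real (G S)
        = ∑ S ∈ 𝒮, ∫ ω, (G S).indicator (fun _ => (1 : ℝ)) ω ∂μ :=
          Finset.sum_congr rfl fun S hS => by
            rw [MeasureTheory.integral_indicator_const _ (hGm S hS), smul_eq_mul, mul_one]
      _ = ∫ ω, ∑ S ∈ 𝒮, (G S).indicator (fun _ => (1 : ℝ)) ω ∂μ :=
          (MeasureTheory.integral_finsetSum _ hi).symm
      _ ≤ ∫ _ω, M ∂μ :=
          MeasureTheory.integral_mono (MeasureTheory.integrable_finsetSum _ hi)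
            (MeasureTheory.integrable_const M) hpt
      _ = M := by simp
  calc α * #𝒮 = ∑ _S ∈ 𝒮, α := by rw [Finset.sum_const, nsmul_eq_mul, mul_comm]
    _ ≤ ∑ S ∈ 𝒮, μ.real (G S) := Finset.sum_le_sum fun S hS => hGα S hS
    _ ≤ M := hint

/-! ### Asymptotics of the parameters -/

open Filter Asymptotics in
-- Used twice: with `a` the degree bound, to make the RBM error negligible against the tolerance,
-- and with `a = 0`, to compare the learning bound with `2 ^ (n ^ δ)`. The factor `1 / 2` lies below
-- `log 2`.
theorem eventually_const_add_log_le (c a : ℝ) {δ : ℝ} (hδ : 0 < δ) :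
    ∀ᶠ x : ℝ in atTop,
      c + a * Real.log x + 3 * (Real.log x * x ^ (δ / 2)) ≤ 1 / 2 * x ^ δ := by
  have h1 : (fun _ : ℝ => c) =o[atTop] fun x : ℝ => x ^ δ :=
    isLittleO_const_left.2 (Or.inr (tendsto_norm_atTop_atTop.comp (tendsto_rpow_atTop hδ)))
  have h2 : (fun x : ℝ => a * Real.log x) =o[atTop] fun x : ℝ => x ^ δ :=
    (isLittleO_log_rpow_atTop hδ).const_mul_left a
  have h3 : (fun x : ℝ => 3 * (Real.log x * x ^ (δ / 2))) =o[atTop] fun x : ℝ => x ^ δ := by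
    refine IsLittleO.const_mul_left ?_ 3
    refine ((isLittleO_log_rpow_atTop (half_pos hδ)).mul_isBigO
      (isBigO_refl (fun x : ℝ => x ^ (δ / 2)) atTop)).congr' EventuallyEq.rfl ?_
    filter_upwards [eventually_gt_atTop 0] with x hx
    rw [← Real.rpow_add hx, add_halves]
  filter_upwards [((h1.add h2).add h3).bound (show (0 : ℝ) < 1 / 2 by norm_num),
    eventually_gt_atTop 0] with x hx hx0
  refine (Real.le_norm_self _).trans (hx.trans_eq ?_)
  rw [Real.norm_of_nonneg (Real.rpow_nonneg hx0.le δ)]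

open Filter in
theorem Polynomial.eventually_eval_le_pow (p : Polynomial ℝ) :
    ∀ᶠ x : ℝ in atTop, p.eval x ≤ x ^ (p.natDegree + 1) := by
  have h := Polynomial.div_tendsto_atTop_zero_of_degree_lt p (Polynomial.X ^ (p.natDegree + 1)) (by
    rw [Polynomial.degree_X_pow]
    exact Polynomial.degree_le_natDegree.trans_lt (by exact_mod_cast Nat.lt_succ_self _))
  filter_upwards [h.eventually_lt_const zero_lt_one, eventually_gt_atTop 0] with x hx hx0
  rw [Polynomial.eval_pow, Polynomial.eval_X, div_lt_one (by positivity)] at hx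
  exact hx.le

theorem RBM.lambdaTwo_nonneg {V H : Type} [Fintype V] (R : RBM V H) : 0 ≤ R.lambdaTwo :=
  Real.iSup_nonneg fun _ => Finset.sum_nonneg fun _ _ => abs_nonneg _

theorem exp_two_mul_sub_one_le {η : ℝ} (h0 : 0 ≤ η) (h1 : η ≤ 1 / 2) :
    Real.exp (2 * η) - 1 ≤ 4 * η := by
  have h := Real.abs_exp_sub_one_le (x := 2 * η) (by rw [abs_le]; constructor <;> linarith)
  rw [abs_of_nonneg (by positivity : 0 ≤ 2 * η)] at h
  linarith [le_abs_self (Real.exp (2 * η) - 1)]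

/-- A class of at least `2 ^ (n ^ δ - 1)` parities is not learnable. -/
theorem not_sqLearnable_of_le_ncard (p : Polynomial ℝ) {δ : ℝ} (hδ : 0 < δ) (hδ1 : δ ≤ 1) :
    ∃ ε : ℝ, 0 < ε ∧ ∀ α : ℝ, 0 < α → ∃ n₀ : ℕ, ∀ m : ℕ, n₀ ≤ m + 1 →
      ∀ 𝒮 : Set (Finset (Fin (m + 1))), 𝒮 ⊆ labelledSets m →
        (2 : ℝ) ^ (((m + 1 : ℕ) : ℝ) ^ δ - 1) ≤ 𝒮.ncard →
      ∀ (R : RBMFamily m) (L : ℝ), AdmissibleFamily 𝒮 R (p.eval ((m + 1 : ℕ) : ℝ)) L →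
        ¬ SQLearnable 𝒮 R
          (((m + 1 : ℕ) : ℝ) ^ (-(L ^ ε))) ⌊((m + 1 : ℕ) : ℝ) ^ (L ^ ε)⌋₊ (1 / 4) α := by
  set d : ℕ := p.natDegree + 1 with hd
  have hd0 : (0 : ℝ) < d := by positivity
  -- Eventually `L ≤ p(n) ≤ n ^ d`, so this `ε` gives `L ^ ε ≤ n ^ (δ / 2)`.
  refine ⟨δ / 2 / d, by positivity, fun α hα => ?_⟩
  have hev := (((eventually_const_add_log_le (Real.log 16) d hδ).and
    (eventually_const_add_log_le (Real.log (80 / α)) 0 hδ)).and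
      p.eventually_eval_le_pow).natCast_atTop
  obtain ⟨n₀, hn₀⟩ := Filter.eventually_atTop.1 hev
  refine ⟨n₀, fun m hm 𝒮 h𝒮 hcard R L hR hlearn => ?_⟩
  obtain ⟨⟨hc1, hc2⟩, hp⟩ := hn₀ (m + 1) hm
  set n : ℝ := ((m + 1 : ℕ) : ℝ) with hn
  have hn1 : 1 ≤ n := by rw [hn]; exact_mod_cast Nat.le_add_left 1 m
  have hn0 : 0 < n := by linarith
  set y : ℝ := Real.log n * n ^ (δ / 2) with hy
  have hy0 : 0 ≤ y := mul_nonneg (Real.log_nonneg hn1) (by positivity)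
  have hny : ∀ s : ℝ, n ^ (s * n ^ (δ / 2)) = Real.exp (s * y) := fun s => by
    rw [Real.rpow_def_of_pos hn0, hy]; ring_nf
  have hnδ : n ^ δ ≤ n := by
    simpa using Real.rpow_le_rpow_of_exponent_le hn1 hδ1
  have hnδ0 : 0 < n ^ δ := by positivity
  -- the parameters of the algorithm
  obtain ⟨hLB, hS⟩ := hR
  -- A member of the class is needed to force `0 ≤ L`, since `L` only bounds the `lambdaTwo` of
  -- members.
  have hne : 𝒮.Nonempty := by
    rw [← Set.ncard_pos]
    have : (0 : ℝ) < 𝒮.ncard := lt_of_lt_of_le (by positivity) hcard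
    exact_mod_cast this
  have hL0 : 0 ≤ L := by
    obtain ⟨S, hS'⟩ := hne
    exact (R S).lambdaTwo_nonneg.trans (hS S hS').1
  have hLε : L ^ (δ / 2 / d) ≤ n ^ (δ / 2) := by
    calc L ^ (δ / 2 / d) ≤ (n ^ d) ^ (δ / 2 / d) :=
          Real.rpow_le_rpow hL0 (hLB.trans hp) (by positivity)
      _ = n ^ (δ / 2) := by
          rw [← Real.rpow_natCast, ← Real.rpow_mul hn0.le]
          congr 1
          field_simp
  set τ₀ : ℝ := n ^ (-(L ^ (δ / 2 / d))) with hτ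
  have hτ0 : 0 < τ₀ := by positivity
  have hτy : Real.exp (-y) ≤ τ₀ := by
    have := hny (-1)
    rw [neg_one_mul, neg_one_mul] at this
    rw [← this, hτ]
    exact Real.rpow_le_rpow_of_exponent_le hn1 (neg_le_neg hLε)
  have hq : ((⌊n ^ (L ^ (δ / 2 / d))⌋₊ : ℕ) : ℝ) ≤ Real.exp y := by
    have := hny 1
    rw [one_mul, one_mul] at this
    rw [← this]
    exact (Nat.floor_le (by positivity)).trans (Real.rpow_le_rpow_of_exponent_le hn1 hLε)
  -- the accuracy of the RBMs
  have hη : 16 * (n ^ d * Real.exp (-n)) ≤ Real.exp (-y) := by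
    have h8 : 16 * (n ^ d * Real.exp (-n)) = Real.exp (Real.log 16 + d * Real.log n - n) := by
      rw [sub_eq_add_neg, Real.exp_add, Real.exp_add, Real.exp_log (by norm_num), mul_comm (d : ℝ),
        Real.exp_mul, Real.exp_log hn0, Real.rpow_natCast, mul_assoc]
    rw [h8]
    exact Real.exp_le_exp.2 (by linarith)
  have hy1 : Real.exp (-y) ≤ 1 := Real.exp_le_one_iff.2 (by linarith)
  have htilt : ∀ S ∈ 𝒮, IsParityTilt (R S).visibleLaw S (Real.exp (-y) / 4) := by
    intro S hSS
    obtain ⟨-, -, C, hC0, hCB, hC⟩ := hS S hSS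
    refine (hC.isParityTilt ⟨_, h𝒮 hSS⟩ hC0).mono ?_
    have hCn : C * Real.exp (-n) ≤ n ^ d * Real.exp (-n) :=
      mul_le_mul_of_nonneg_right (hCB.trans hp) (Real.exp_pos _).le
    refine (exp_two_mul_sub_one_le (by positivity) ?_).trans ?_ <;> linarith
  have hfin : 𝒮.Finite := Set.toFinite 𝒮
  have hcoe : ((hfin.toFinset : Finset _) : Set (Finset (Fin (m + 1)))) = 𝒮 := hfin.coe_toFinset
  have hmain := SQLearnable.mul_card_le (𝒮 := hfin.toFinset) (e := Real.exp (-y) / 4) (α := α)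
    (R := R) hτ0 (by linarith) (by linarith) (fun S hSS => h𝒮 (hfin.mem_toFinset.1 hSS))
    (fun S hSS => htilt S (hfin.mem_toFinset.1 hSS)) (by rwa [hcoe])
  rw [← Set.ncard_eq_toFinset_card 𝒮 hfin] at hmain
  have h4 : 4 / τ₀ ^ 2 ≤ 4 * Real.exp (2 * y) := by
    rw [div_le_iff₀ (by positivity)]
    have h5 : 1 ≤ Real.exp y * τ₀ := by
      calc (1 : ℝ) = Real.exp y * Real.exp (-y) := by rw [← Real.exp_add]; simp
        _ ≤ _ := mul_le_mul_of_nonneg_left hτy (Real.exp_pos _).le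
    have h6 : Real.exp (2 * y) = Real.exp y ^ 2 := by rw [← Real.exp_nat_mul]; norm_num
    rw [h6, mul_assoc, ← mul_pow]
    nlinarith
  -- Here `20 = 4 + 16`: queries cost `exp y * (4 * exp (2 * y))`, and the final hypothesis costs
  -- 16.
  have h7 : α * 𝒮.ncard ≤ 20 * Real.exp (3 * y) := by
    have h8 : Real.exp y * (4 * Real.exp (2 * y)) = 4 * Real.exp (3 * y) := by
      rw [show 3 * y = y + 2 * y by ring, Real.exp_add]; ring
    have h9 : 1 ≤ Real.exp (3 * y) := Real.one_le_exp (by positivity)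
    have h10 := mul_le_mul hq h4 (by positivity) (Real.exp_pos y).le
    linarith
  have h11 : 80 / α * Real.exp (3 * y) ≤ 2 ^ (n ^ δ) := by
    rw [← Real.exp_log (show 0 < 80 / α by positivity), ← Real.exp_add,
      Real.rpow_def_of_pos two_pos]
    refine Real.exp_le_exp.2 ?_
    have hlog2 := Real.log_two_gt_d9
    nlinarith
  have h12 : (2 : ℝ) ^ (n ^ δ - 1) = 2 ^ (n ^ δ) / 2 := by
    rw [Real.rpow_sub two_pos, Real.rpow_one]
  rw [h12] at hcard
  have h13 : 80 * Real.exp (3 * y) ≤ α * 2 ^ (n ^ δ) := by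
    have := mul_le_mul_of_nonneg_left h11 hα.le
    rwa [← mul_assoc, mul_div_cancel₀ _ hα.ne'] at this
  have h14 : α * (2 ^ (n ^ δ) / 2) ≤ α * 𝒮.ncard := mul_le_mul_of_nonneg_left hcard hα.le
  linarith [Real.exp_pos (3 * y)]

/-! ### Counting the target sets -/

/-- The set with label unit whose inputs are `T`. -/
def withLabel {m : ℕ} (T : Finset (Fin m)) : Finset (Fin (m + 1)) :=
  insert (Fin.last m) (T.map Fin.castSuccEmb)

theorem last_notMem_map_castSucc {m : ℕ} (T : Finset (Fin m)) :
    Fin.last m ∉ T.map Fin.castSuccEmb := by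
  simp [Fin.castSucc_ne_last]

theorem withLabel_injective {m : ℕ} : Function.Injective (withLabel (m := m)) := by
  intro T T' h
  have h' := congrArg (fun U => U.erase (Fin.last m)) h
  simp only [withLabel, Finset.erase_insert (last_notMem_map_castSucc _)] at h'
  exact Finset.map_injective _ h'

theorem card_withLabel {m : ℕ} (T : Finset (Fin m)) : (withLabel T).card = T.card + 1 := by
  rw [withLabel, Finset.card_insert_of_notMem (last_notMem_map_castSucc T), Finset.card_map]

theorem choose_le_ncard_labelledSetsOfCard (m j : ℕ) :
    m.choose j ≤ (labelledSetsOfCard m (j + 1)).ncard := by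
  have h : withLabel '' (Finset.powersetCard j (Finset.univ : Finset (Fin m)) : Set _) ⊆
      labelledSetsOfCard m (j + 1) := by
    rintro _ ⟨T, hT, rfl⟩
    have hT' := (Finset.mem_powersetCard.1 hT).2
    exact ⟨Finset.mem_insert_self _ _, by rw [card_withLabel, hT']⟩
  have := Set.ncard_le_ncard h (Set.toFinite _)
  rwa [Set.ncard_image_of_injective _ withLabel_injective, Set.ncard_coe_finset,
    Finset.card_powersetCard, Finset.card_univ, Fintype.card_fin] at this

theorem two_pow_le_ncard_labelledSets (m : ℕ) : 2 ^ m ≤ (labelledSets m).ncard := by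
  have h : Set.range (withLabel (m := m)) ⊆ labelledSets m := by
    rintro _ ⟨T, rfl⟩
    exact Finset.mem_insert_self _ _
  have := Set.ncard_le_ncard h (Set.toFinite _)
  rwa [← Set.image_univ, Set.ncard_image_of_injective _ withLabel_injective, Set.ncard_univ,
    Nat.card_eq_fintype_card, Fintype.card_finset, Fintype.card_fin] at this

/-- The ratio of consecutive terms is `2 * (2 * a + 1) / (a + 1) ≥ 2`. -/
theorem two_pow_le_centralBinom (a : ℕ) : 2 ^ a ≤ a.centralBinom := by
  induction a with
  | zero => simp
  | succ a ih =>
    have h := Nat.succ_mul_centralBinom_succ a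
    rw [pow_succ]
    by_contra hcon
    push Not at hcon
    have h1 : (a + 1).centralBinom < 2 * a.centralBinom := by omega
    nlinarith

theorem two_pow_le_choose {a N : ℕ} (h : 2 * a ≤ N) : 2 ^ a ≤ N.choose a :=
  (two_pow_le_centralBinom a).trans (Nat.choose_le_choose a h)

theorem two_rpow_le_choose {m j : ℕ} {r : ℝ} (h1 : r ≤ j) (h2 : r ≤ m - j) (hj : j ≤ m) :
    (2 : ℝ) ^ r ≤ m.choose j := by
  have key : ∀ i : ℕ, r ≤ i → 2 * i ≤ m → (2 : ℝ) ^ r ≤ m.choose i := fun i hri him => by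
    calc (2 : ℝ) ^ r ≤ 2 ^ (i : ℝ) := Real.rpow_le_rpow_of_exponent_le one_le_two hri
      _ = ((2 ^ i : ℕ) : ℝ) := by rw [Real.rpow_natCast]; push_cast; rfl
      _ ≤ _ := by exact_mod_cast two_pow_le_choose him
  rcases le_total (2 * j) m with h | h
  · exact key j h1 h
  · rw [← Nat.choose_symm hj]
    exact key (m - j) (by rwa [Nat.cast_sub hj]) (by omega)

theorem not_sqLearnable_labelledSets (p : Polynomial ℝ) :
    ∃ ε : ℝ, 0 < ε ∧ ∀ α : ℝ, 0 < α → ∃ n₀ : ℕ, ∀ m : ℕ, n₀ ≤ m + 1 →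
      ∀ (R : RBMFamily m) (L : ℝ),
        AdmissibleFamily (labelledSets m) R (p.eval ((m + 1 : ℕ) : ℝ)) L →
        ¬ SQLearnable (labelledSets m) R
          (((m + 1 : ℕ) : ℝ) ^ (-(L ^ ε))) ⌊((m + 1 : ℕ) : ℝ) ^ (L ^ ε)⌋₊ (1 / 4) α := by
  obtain ⟨ε, hε, h⟩ := not_sqLearnable_of_le_ncard p one_pos le_rfl
  refine ⟨ε, hε, fun α hα => (h α hα).imp fun n₀ hn₀ m hm => hn₀ m hm _ subset_rfl ?_⟩
  calc (2 : ℝ) ^ (((m + 1 : ℕ) : ℝ) ^ (1 : ℝ) - 1) = ((2 ^ m : ℕ) : ℝ) := by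
        rw [Real.rpow_one, Nat.cast_add_one, add_sub_cancel_right, Real.rpow_natCast]
        push_cast
        rfl
    _ ≤ _ := by exact_mod_cast two_pow_le_ncard_labelledSets m

theorem not_sqLearnable_labelledSetsOfCard (p : Polynomial ℝ) (δ : ℝ) (hδ : 0 < δ) :
    ∃ ε : ℝ, 0 < ε ∧ ∀ α : ℝ, 0 < α → ∃ n₀ : ℕ, ∀ m : ℕ, n₀ ≤ m + 1 →
      ∀ k : ℕ, ((m + 1 : ℕ) : ℝ) ^ δ ≤ (k : ℝ) →
        (k : ℝ) ≤ ((m + 1 : ℕ) : ℝ) - ((m + 1 : ℕ) : ℝ) ^ δ →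
      ∀ (R : RBMFamily m) (L : ℝ),
        AdmissibleFamily (labelledSetsOfCard m k) R (p.eval ((m + 1 : ℕ) : ℝ)) L →
        ¬ SQLearnable (labelledSetsOfCard m k) R
          (((m + 1 : ℕ) : ℝ) ^ (-(L ^ ε))) ⌊((m + 1 : ℕ) : ℝ) ^ (L ^ ε)⌋₊ (1 / 4) α := by
  obtain ⟨ε, hε, h⟩ := not_sqLearnable_of_le_ncard p (lt_min hδ one_pos) (min_le_right δ 1)
  refine ⟨ε, hε, fun α hα => (h α hα).imp fun n₀ hn₀ m hm k hk1 hk2 =>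
    hn₀ m hm _ (fun S hS => hS.1) ?_⟩
  have hn1 : (1 : ℝ) ≤ ((m + 1 : ℕ) : ℝ) := by exact_mod_cast Nat.le_add_left 1 m
  have hle := Real.rpow_le_rpow_of_exponent_le hn1 (min_le_left δ 1)
  have h1 := Real.one_le_rpow hn1 hδ.le
  -- The label takes one of the `k` places, which is why the required size is `2 ^ (n ^ δ - 1)`.
  obtain ⟨j, rfl⟩ : ∃ j, k = j + 1 :=
    Nat.exists_eq_succ_of_ne_zero fun h0 => by rw [h0, Nat.cast_zero] at hk1; linarith
  push_cast at *
  have hjm : j ≤ m := by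
    have : (j : ℝ) ≤ m := by linarith
    exact_mod_cast this
  refine (two_rpow_le_choose (j := j) (m := m) ?_ ?_ hjm).trans
    (by exact_mod_cast choose_le_ncard_labelledSetsOfCard m j) <;> linarith

/-! ### The visible marginal of an RBM -/

section Marginal

variable {V H : Type} [Fintype V] [Fintype H] [DecidableEq H]

/-- The field that the visible units exert on the hidden unit `j`. -/
def RBM.hiddenField (R : RBM V H) (x : V → ℤˣ) (j : H) : ℝ :=
  ∑ i, ((x i : ℤ) : ℝ) * R.W i j + R.bH j

theorem sum_units_exp (θ : ℝ) : ∑ u : ℤˣ, Real.exp (θ * ((u : ℤ) : ℝ)) = 2 * Real.cosh θ := by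
  have : (Finset.univ : Finset ℤˣ) = {1, -1} := rfl
  rw [this, Finset.sum_pair (by decide), Real.cosh_eq]
  simp
  ring

theorem RBM.sum_jointWeight (R : RBM V H) (x : V → ℤˣ) :
    ∑ h, R.jointWeight x h =
      Real.exp (∑ i, R.bV i * ((x i : ℤ) : ℝ) +
        ∑ j, Real.log (2 * Real.cosh (R.hiddenField x j))) := by
  have h1 : ∀ h, R.jointWeight x h = Real.exp (∑ i, R.bV i * ((x i : ℤ) : ℝ)) *
      ∏ j, Real.exp (R.hiddenField x j * ((h j : ℤ) : ℝ)) := fun h => by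
    rw [← Real.exp_sum, ← Real.exp_add, RBM.jointWeight]
    congr 1
    simp only [RBM.hiddenField, add_mul, Finset.sum_add_distrib, Finset.sum_mul]
    rw [Finset.sum_comm]
    ring
  simp only [h1]
  have h2 := Finset.prod_univ_sum (fun _ : H => (Finset.univ : Finset ℤˣ))
    fun j u => Real.exp (R.hiddenField x j * ((u : ℤ) : ℝ))
  rw [Fintype.piFinset_univ] at h2
  rw [← Finset.mul_sum, Real.exp_add, ← h2]
  congr 1
  rw [Real.exp_sum]
  refine Finset.prod_congr rfl fun j _ => ?_
  rw [sum_units_exp, Real.exp_log (by positivity)]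

/-- The free constant `c` cancels in the normalisation; it will absorb everything that does not
depend on `x`. -/
theorem RBM.visibleLaw_eq [DecidableEq V] (R : RBM V H) (c : ℝ) (x : V → ℤˣ) :
    R.visibleLaw x =
      Real.exp (∑ i, R.bV i * ((x i : ℤ) : ℝ) +
        ∑ j, Real.log (2 * Real.cosh (R.hiddenField x j)) - c) /
      ∑ x' : V → ℤˣ, Real.exp (∑ i, R.bV i * ((x' i : ℤ) : ℝ) +
        ∑ j, Real.log (2 * Real.cosh (R.hiddenField x' j)) - c) := by
  simp only [RBM.visibleLaw, RBM.sum_jointWeight, Real.exp_sub]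
  rw [← Finset.sum_div, div_div_div_cancel_right₀ (Real.exp_pos c).ne']

end Marginal

theorem abs_log_two_mul_cosh_sub_le (θ : ℝ) :
    |Real.log (2 * Real.cosh θ) - (|θ|)| ≤ Real.exp (-(2 * |θ|)) := by
  have h : 2 * Real.cosh θ = Real.exp |θ| * (1 + Real.exp (-(2 * |θ|))) := by
    rw [← Real.cosh_abs, Real.cosh_eq, mul_add, ← Real.exp_add]
    ring_nf
  have h0 := Real.exp_pos (-(2 * |θ|))
  rw [h, Real.log_mul (Real.exp_pos _).ne' (by positivity), Real.log_exp, add_sub_cancel_left,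
    abs_of_nonneg (Real.log_nonneg (by linarith))]
  linarith [Real.log_le_sub_one_of_pos (show 0 < 1 + Real.exp (-(2 * |θ|)) by positivity)]

/-! ### The parity as a function of the sum of the spins -/

theorem exists_sum_eq_and_parity_eq {ι : Type} (S : Finset ι) (x : ι → ℤˣ) :
    ∃ t ≤ #S, ∑ i ∈ S, ((x i : ℤ) : ℝ) = #S - 2 * t ∧ ((parity S x : ℤ) : ℝ) = (-1) ^ t := by
  classical
  induction S using Finset.induction_on with
  | empty => exact ⟨0, le_rfl, by simp, by simp [parity]⟩
  | insert a S ha ih =>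
    obtain ⟨t, ht, hs, hp⟩ := ih
    have hpar : ((parity (insert a S) x : ℤ) : ℝ) = ((x a : ℤ) : ℝ) * ((parity S x : ℤ) : ℝ) := by
      rw [parity, Finset.prod_insert ha, Units.val_mul, Int.cast_mul, parity]
    rw [hpar, Finset.sum_insert ha, Finset.card_insert_of_notMem ha, hs, hp]
    rcases Int.units_eq_one_or (x a) with h | h
    · exact ⟨t, by omega, by rw [h]; push_cast; ring, by rw [h]; simp⟩
    · exact ⟨t + 1, by omega, by rw [h]; push_cast; ring, by rw [h, pow_succ]; push_cast; ring⟩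

theorem sum_range_abs_sub {t k : ℕ} (h : t ≤ k) :
    ∑ u ∈ range (k + 1), |(t : ℝ) - u| = ((t : ℝ) * (t + 1) + (k - t) * (k - t + 1)) / 2 := by
  induction k, h using Nat.le_induction with
  | base =>
    have h1 : ∀ N : ℕ, ∑ u ∈ range N, ((t : ℝ) - u) = N * t - N * (N - 1) / 2 := fun N => by
      induction N with
      | zero => simp
      | succ N ih => rw [Finset.sum_range_succ, ih]; push_cast; ring
    have h2 : ∀ u ∈ range (t + 1), |(t : ℝ) - u| = t - u := fun u hu => abs_of_nonneg
      (sub_nonneg.2 (Nat.cast_le.2 (Nat.lt_succ_iff.1 (Finset.mem_range.1 hu))))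
    rw [Finset.sum_congr rfl h2, h1]
    push_cast
    ring
  | succ k hk ih =>
    have hk' : (t : ℝ) ≤ k := by exact_mod_cast hk
    rw [Finset.sum_range_succ, ih, abs_of_nonpos (by push_cast; linarith)]
    push_cast
    ring

/-- Alternating kinks at consecutive integers form a zigzag, whose values at the integers alternate
about a line. The line has slope 0 for even `k` and 1 for odd `k`. -/
theorem sum_range_neg_one_pow_mul_abs_sub {t k : ℕ} (h : t ≤ k) :
    ∑ u ∈ range (k + 1), (-1 : ℝ) ^ u * |(t : ℝ) - u| =
      -(-1) ^ t / 2 + ((-1) ^ k * (2 * k + 1) + 1) / 4 + (1 - (-1) ^ k) / 2 * t := by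
  induction k, h using Nat.le_induction with
  | base =>
    have h1 : ∀ N : ℕ, ∑ u ∈ range (N + 1), (-1 : ℝ) ^ u * ((t : ℝ) - u) =
        t * (1 + (-1) ^ N) / 2 - ((-1) ^ N * (2 * N + 1) - 1) / 4 := fun N => by
      induction N with
      | zero => norm_num
      | succ N ih => rw [Finset.sum_range_succ, ih, pow_succ]; push_cast; ring
    have h2 : ∀ u ∈ range (t + 1), (-1 : ℝ) ^ u * |(t : ℝ) - u| = (-1) ^ u * (t - u) :=
      fun u hu => by rw [abs_of_nonneg
        (sub_nonneg.2 (Nat.cast_le.2 (Nat.lt_succ_iff.1 (Finset.mem_range.1 hu))))]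
    rw [Finset.sum_congr rfl h2, h1]
    ring
  | succ k hk ih =>
    have hk' : (t : ℝ) ≤ k := by exact_mod_cast hk
    rw [Finset.sum_range_succ, ih, abs_of_nonpos (by push_cast; linarith), pow_succ]
    push_cast
    ring

/-- The weight into the hidden unit with threshold `k - 2 * u`. -/
def thresholdWeight (C : ℝ) (u : ℕ) : ℝ := C * (2 - (-1) ^ u)

theorem le_thresholdWeight {C : ℝ} (hC : 0 ≤ C) (u : ℕ) :
    C ≤ thresholdWeight C u ∧ thresholdWeight C u ≤ 3 * C := by
  rcases neg_one_pow_eq_or ℝ u with h | h <;> rw [thresholdWeight, h] <;> constructor <;> linarith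

/-- The unit with `u = t` has zero field and contributes exactly `log 2`; every other field is at
least `2 * C` in absolute value. -/
theorem abs_sum_threshold_sub_le {C : ℝ} (hC : 0 ≤ C) {t k : ℕ} (h : t ≤ k) :
    |∑ u ∈ range (k + 1), Real.log (2 * Real.cosh (thresholdWeight C u *
        (((k : ℝ) - 2 * t) - (k - 2 * u)))) -
      (∑ u ∈ range (k + 1), thresholdWeight C u * (2 * |(t : ℝ) - u|) + Real.log 2)| ≤
      (k + 1) * Real.exp (-(4 * C)) := by
  have hlog : Real.log 2 = ∑ u ∈ range (k + 1), if u = t then Real.log 2 else 0 := by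
    rw [Finset.sum_ite_eq', if_pos (Finset.mem_range.2 (by omega))]
  rw [hlog, ← Finset.sum_add_distrib, ← Finset.sum_sub_distrib]
  refine (Finset.abs_sum_le_sum_abs _ _).trans ?_
  have hsum : ((k : ℝ) + 1) * Real.exp (-(4 * C)) =
      ∑ _u ∈ range (k + 1), Real.exp (-(4 * C)) := by
    rw [Finset.sum_const, Finset.card_range, nsmul_eq_mul]; push_cast; rfl
  rw [hsum]
  refine Finset.sum_le_sum fun u _ => ?_
  obtain ⟨hw, -⟩ := le_thresholdWeight hC u
  split_ifs with hu
  · subst hu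
    simp [(Real.exp_pos _).le]
  · have habs : |thresholdWeight C u * (((k : ℝ) - 2 * t) - (k - 2 * u))| =
        thresholdWeight C u * (2 * |(t : ℝ) - u|) := by
      rw [abs_mul, abs_of_nonneg (hC.trans hw), show ((k : ℝ) - 2 * t) - (k - 2 * u) =
        -(2 * ((t : ℝ) - u)) by ring, abs_neg, abs_mul, abs_two]
    have hone : (1 : ℝ) ≤ |(t : ℝ) - u| := by
      have : (1 : ℤ) ≤ |(t : ℤ) - u| := Int.one_le_abs (by omega)
      exact_mod_cast this
    rw [add_zero, ← habs]
    refine (abs_log_two_mul_cosh_sub_le _).trans (Real.exp_le_exp.2 ?_)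
    rw [habs]
    nlinarith [mul_le_mul hw hone zero_le_one (hC.trans hw)]

theorem sum_thresholdWeight_mul (C : ℝ) {t k : ℕ} (h : t ≤ k) :
    ∑ u ∈ range (k + 1), thresholdWeight C u * (2 * |(t : ℝ) - u|) =
      C * (((k : ℝ) - 2 * t) ^ 2 + k ^ 2 + 2 * k + (-1) ^ t -
        ((-1) ^ k * (2 * k + 1) + 1) / 2 - (1 - (-1) ^ k) * t) := by
  have : ∀ u : ℕ, thresholdWeight C u * (2 * |(t : ℝ) - u|) =
      4 * C * |(t : ℝ) - u| - 2 * C * ((-1) ^ u * |(t : ℝ) - u|) := fun u => by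
    rw [thresholdWeight]; ring
  simp only [this]
  rw [Finset.sum_sub_distrib, ← Finset.mul_sum, ← Finset.mul_sum, sum_range_abs_sub h,
    sum_range_neg_one_pow_mul_abs_sub h]
  ring

/-- The field takes only the values `0` and `±2 * w`, so a pair unit is exactly a two-spin
interaction. Its negative sign is what cancels the square from the thresholds. -/
theorem log_two_mul_cosh_pair (w : ℝ) (u v : ℤˣ) :
    Real.log (2 * Real.cosh (w * (((u : ℤ) : ℝ) - ((v : ℤ) : ℝ)))) =
      Real.log 2 + (1 - ((u : ℤ) : ℝ) * ((v : ℤ) : ℝ)) / 2 * Real.log (Real.cosh (2 * w)) := by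
  have hc := (Real.cosh_pos (2 * w)).ne'
  have h1 : Real.log (2 * Real.cosh (w * 2)) = Real.log 2 + Real.log (Real.cosh (2 * w)) := by
    rw [mul_comm w, Real.log_mul two_ne_zero hc]
  have h2 : w * (-1 - 1) = -(w * 2) := by ring
  rcases Int.units_eq_one_or u with rfl | rfl <;> rcases Int.units_eq_one_or v with rfl | rfl
  · simp
  · norm_num [h1]
  · simp only [Units.val_neg, Units.val_one, Int.cast_neg, Int.cast_one, h2, Real.cosh_neg, h1]
    ring
  · simp

/-! ### The RBM of a parity -/

theorem nonempty_equiv_option {V : Type} (S : Finset V) :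
    Nonempty (Fin (#S ^ 2 + 1) ≃ Option (S × S)) :=
  ⟨Fintype.equivOfCardEq (by simp [sq])⟩

section ParityRBM

variable {V : Type} [DecidableEq V]

/-- The hidden units are indexed by `Option (S × S)`: the off-diagonal pairs give
antiferromagnetic interactions, the diagonal pairs and `none` give thresholds. -/
noncomputable def parityWeights (S : Finset V) (C w : ℝ) (i : V) : Option (S × S) → ℝ
  | none => if i ∈ S then thresholdWeight C #S else 0
  | some (a, b) =>
    if a = b then if i ∈ S then thresholdWeight C (S.equivFin a) else 0
    else w * ((if i = a then 1 else 0) - if i = b then 1 else 0)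

/-- The external fields of the hidden units. -/
noncomputable def parityBias (S : Finset V) (C : ℝ) : Option (S × S) → ℝ
  | none => -(thresholdWeight C #S * (#S - 2 * #S))
  | some (a, b) =>
    if a = b then -(thresholdWeight C (S.equivFin a) * (#S - 2 * (S.equivFin a : ℕ))) else 0

/-- An RBM whose visible law is approximately that of the parity on `S`. -/
noncomputable def parityRBM (S : Finset V) (C w : ℝ) : RBM V (Fin (#S ^ 2 + 1)) where
  W i j := parityWeights S C w i ((nonempty_equiv_option S).some j)
  bV i := if i ∈ S then -(C * ((1 - (-1) ^ #S) / 2)) else 0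
  bH j := parityBias S C ((nonempty_equiv_option S).some j)

theorem parityWeights_eq_zero {S : Finset V} {i : V} (hi : i ∉ S) (C w : ℝ)
    (j : Option (S × S)) : parityWeights S C w i j = 0 := by
  rcases j with _ | ⟨a, b⟩
  · exact if_neg hi
  · have ha : i ≠ a := fun h => hi (h ▸ a.2)
    have hb : i ≠ b := fun h => hi (h ▸ b.2)
    simp [parityWeights, hi, ha, hb]

theorem abs_parityWeights_le (S : Finset V) {C w : ℝ} (hC : 0 ≤ C) (hCw : C ≤ w) (i : V)
    (j : Option (S × S)) : |parityWeights S C w i j| ≤ 3 * w := by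
  have hw : 0 ≤ w := hC.trans hCw
  have ht : ∀ u, |thresholdWeight C u| ≤ 3 * w := fun u => by
    obtain ⟨h1, h2⟩ := le_thresholdWeight hC u
    rw [abs_of_nonneg (hC.trans h1)]
    linarith
  rcases j with _ | ⟨a, b⟩
  · simp only [parityWeights]
    split_ifs
    · exact ht _
    · simpa using hw
  · simp only [parityWeights]
    split_ifs <;> first | exact ht _ | (simp [abs_of_nonneg hw]; try linarith)

variable [Fintype V]

/-- The field on a hidden unit. -/
theorem sum_mul_parityWeights_add (S : Finset V) (C w : ℝ) (x : V → ℤˣ) (j : Option (S × S)) :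
    ∑ i, ((x i : ℤ) : ℝ) * parityWeights S C w i j + parityBias S C j =
      match j with
      | none => thresholdWeight C #S * (∑ i ∈ S, ((x i : ℤ) : ℝ) - (#S - 2 * #S))
      | some (a, b) =>
        if a = b then thresholdWeight C (S.equivFin a) *
          (∑ i ∈ S, ((x i : ℤ) : ℝ) - (#S - 2 * (S.equivFin a : ℕ)))
        else w * (((x a : ℤ) : ℝ) - ((x b : ℤ) : ℝ)) := by
  have hthr : ∀ c : ℝ, ∑ i, ((x i : ℤ) : ℝ) * (if i ∈ S then c else 0) =
      c * ∑ i ∈ S, ((x i : ℤ) : ℝ) := fun c => by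
    simp only [mul_ite, mul_zero]
    rw [Finset.sum_ite_mem, Finset.univ_inter, ← Finset.sum_mul, mul_comm]
  rcases j with _ | ⟨a, b⟩
  · simp only [parityWeights, parityBias, hthr]
    ring
  · simp only [parityWeights, parityBias]
    split_ifs with hab
    · rw [hthr]
      ring
    · have : ∀ i, ((x i : ℤ) : ℝ) * (w * ((if i = a then 1 else 0) - if i = b then 1 else 0)) =
          (if i = a then w * ((x i : ℤ) : ℝ) else 0) -
            if i = b then w * ((x i : ℤ) : ℝ) else 0 := fun i => by
        split_ifs <;> ring
      simp only [this]
      rw [Finset.sum_sub_distrib, Finset.sum_ite_eq', Finset.sum_ite_eq']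
      simp only [Finset.mem_univ, if_true]
      ring

/-- The contribution of the hidden units to the exponent of the visible law. -/
theorem sum_log_cosh_parityRBM (S : Finset V) (C w : ℝ) (x : V → ℤˣ) :
    ∑ j, Real.log (2 * Real.cosh ((parityRBM S C w).hiddenField x j)) =
      ∑ u ∈ range (#S + 1), Real.log (2 * Real.cosh (thresholdWeight C u *
        (∑ i ∈ S, ((x i : ℤ) : ℝ) - (#S - 2 * u)))) +
      ((#S ^ 2 - #S) * Real.log 2 +
        ((#S : ℝ) ^ 2 - (∑ i ∈ S, ((x i : ℤ) : ℝ)) ^ 2) / 2 * Real.log (Real.cosh (2 * w))) := by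
  set s := ∑ i ∈ S, ((x i : ℤ) : ℝ) with hs
  set T : ℕ → ℝ := fun u => Real.log (2 * Real.cosh (thresholdWeight C u * (s - (#S - 2 * u))))
    with hT
  set P : S → S → ℝ := fun a b =>
    Real.log (2 * Real.cosh (w * (((x a : ℤ) : ℝ) - ((x b : ℤ) : ℝ)))) with hP
  have h1 : ∑ j, Real.log (2 * Real.cosh ((parityRBM S C w).hiddenField x j)) =
      T #S + ∑ a : S, ∑ b : S, if a = b then T (S.equivFin a) else P a b := by
    simp only [RBM.hiddenField, parityRBM]
    rw [Equiv.sum_comp (nonempty_equiv_option S).some fun j => Real.log (2 * Real.cosh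
      (∑ i, ((x i : ℤ) : ℝ) * parityWeights S C w i j + parityBias S C j)), Fintype.sum_option,
      Fintype.sum_prod_type]
    simp only [sum_mul_parityWeights_add]
    congr 1
    refine Finset.sum_congr rfl fun a _ => Finset.sum_congr rfl fun b _ => ?_
    split_ifs <;> rfl
  -- A diagonal pair unit would contribute `log 2`. Adding and subtracting it completes the double
  -- sum to the full square of the spin sum.
  have h2 : ∀ a b : S, (if a = b then T (S.equivFin a) else P a b) =
      P a b + if a = b then T (S.equivFin a) - Real.log 2 else 0 := fun a b => by
    split_ifs with hab
    · subst hab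
      simp [hP]
    · rw [add_zero]
  have h3 : ∑ a : S, T (S.equivFin a) = ∑ u ∈ range #S, T u := by
    rw [Equiv.sum_comp S.equivFin fun u : Fin #S => T u, Fin.sum_univ_eq_sum_range]
  have hsS : s = ∑ a : S, ((x a : ℤ) : ℝ) := (Finset.sum_coe_sort S fun i => ((x i : ℤ) : ℝ)).symm
  have h4 : ∑ a : S, ∑ b : S, P a b = #S ^ 2 * Real.log 2 +
      ((#S : ℝ) ^ 2 - s ^ 2) / 2 * Real.log (Real.cosh (2 * w)) := by
    simp only [hP, log_two_mul_cosh_pair, Finset.sum_add_distrib, ← Finset.sum_mul,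
      ← Finset.sum_div, Finset.sum_sub_distrib, ← Finset.mul_sum]
    rw [← hsS]
    simp
    ring
  rw [h1]
  simp only [h2, Finset.sum_add_distrib, Finset.sum_ite_eq, Finset.mem_univ, if_true, h4,
    Finset.sum_sub_distrib, h3]
  rw [Finset.sum_range_succ]
  simp
  ring

/-- Up to a constant, the exponent of the visible law is close to `C * parity S`. -/
theorem exists_abs_parityRBM_sub_le (S : Finset V) {C w : ℝ} (hC : 0 ≤ C)
    (hw : Real.log (Real.cosh (2 * w)) = 2 * C) :
    ∃ c : ℝ, ∀ x : V → ℤˣ,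
      |∑ i, (parityRBM S C w).bV i * ((x i : ℤ) : ℝ) +
        ∑ j, Real.log (2 * Real.cosh ((parityRBM S C w).hiddenField x j)) - c -
        C * ((parity S x : ℤ) : ℝ)| ≤ (#S + 1) * Real.exp (-(4 * C)) := by
  -- All the terms independent of `t`: thresholds and pairs each give `C * #S ^ 2`, and the extra
  -- `log 2` is that of the threshold unit at zero field. The choice `log (cosh (2 * w)) = 2 * C`
  -- makes the squares cancel.
  refine ⟨C * (2 * #S ^ 2 + 2 * #S - ((-1) ^ #S * (2 * #S + 1) + 1) / 2 -
    (1 - (-1) ^ #S) / 2 * #S) + (#S ^ 2 - #S + 1) * Real.log 2, fun x => ?_⟩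
  obtain ⟨t, ht, hs, hp⟩ := exists_sum_eq_and_parity_eq S x
  have hb : ∑ i, (parityRBM S C w).bV i * ((x i : ℤ) : ℝ) =
      -(C * ((1 - (-1) ^ #S) / 2)) * (#S - 2 * t) := by
    simp only [parityRBM, ite_mul, zero_mul]
    rw [Finset.sum_ite_mem, Finset.univ_inter, ← Finset.mul_sum, hs]
  have h := abs_sum_threshold_sub_le hC ht
  rw [sum_thresholdWeight_mul C ht] at h
  rw [hb, sum_log_cosh_parityRBM, hs, hp, hw]
  convert h using 2
  ring

end ParityRBM

theorem approximatesParity_parityRBM {m : ℕ} {S : Finset (Fin (m + 1))} {C w : ℝ}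
    (hC : ((m + 1 : ℕ) : ℝ) ≤ C) (hw : Real.log (Real.cosh (2 * w)) = 2 * C) :
    ApproximatesParity (parityRBM S C w) S C := by
  set n : ℝ := ((m + 1 : ℕ) : ℝ) with hn
  have hn1 : 1 ≤ n := by rw [hn]; exact_mod_cast Nat.le_add_left 1 m
  have hC0 : 0 < C := by linarith
  have hS : (#S : ℝ) ≤ n := by
    rw [hn]; exact_mod_cast (Finset.card_le_univ S).trans_eq (Fintype.card_fin _)
  obtain ⟨c, hc⟩ := exists_abs_parityRBM_sub_le S hC0.le hw
  refine ⟨fun i hi => ⟨fun j => parityWeights_eq_zero hi C w _, if_neg hi⟩, _,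
    RBM.visibleLaw_eq _ c, fun x => ?_⟩
  rw [div_sub' hC0.ne', abs_div, abs_of_pos hC0, div_le_iff₀ hC0]
  refine (hc x).trans ?_
  have h1 : Real.exp (-(4 * C)) ≤ Real.exp (-n) * Real.exp (-(3 * n)) := by
    rw [← Real.exp_add]
    exact Real.exp_le_exp.2 (by linarith)
  have h2 : 2 * Real.exp (-(3 * n)) ≤ 1 := by
    have h3 := Real.add_one_le_exp (3 * n)
    have h4 : Real.exp (3 * n) * Real.exp (-(3 * n)) = 1 := by rw [← Real.exp_add]; simp
    nlinarith [Real.exp_pos (-(3 * n))]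
  have h5 := Real.exp_pos (-n)
  calc ((#S : ℝ) + 1) * Real.exp (-(4 * C))
      ≤ (2 * C) * (Real.exp (-n) * Real.exp (-(3 * n))) :=
        mul_le_mul (by linarith) h1 (Real.exp_pos _).le (by linarith)
    _ = (Real.exp (-n) * C) * (2 * Real.exp (-(3 * n))) := by ring
    _ ≤ Real.exp (-n) * C := mul_le_of_le_one_right (by positivity) h2

/-! ### Polynomial bounds on the parameters -/

theorem lambdaTwo_parityRBM_le {V : Type} [DecidableEq V] [Fintype V] (S : Finset V) {C w : ℝ}
    (hC : 0 ≤ C) (hCw : C ≤ w) :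
    (parityRBM S C w).lambdaTwo ≤ Fintype.card V * (3 * w) := by
  refine ciSup_le fun j => ?_
  calc ∑ i, |(parityRBM S C w).W i j| ≤ ∑ _i : V, 3 * w :=
        Finset.sum_le_sum fun i _ => abs_parityWeights_le S hC hCw i _
    _ = Fintype.card V * (3 * w) := by simp

theorem RBM.topNorm_le_card {V H : Type} [Fintype V] [Fintype H] (R : RBM V H) (i : V) :
    R.topNorm i ≤ Fintype.card H := by
  calc R.topNorm i ≤ ∑ _j : H, (1 : ℝ) :=
        Finset.sum_le_sum fun j _ => (Real.abs_tanh_lt_one _).le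
    _ = Fintype.card H := by simp

/-- `exp (2 * w - 1) ≤ exp (2 * w) / 2 ≤ cosh (2 * w) ≤ exp (2 * w)`. -/
theorem half_log_cosh_bounds {w : ℝ} (hw : 1 ≤ w) :
    w - 1 ≤ Real.log (Real.cosh (2 * w)) / 2 ∧ Real.log (Real.cosh (2 * w)) / 2 ≤ w := by
  have hc := Real.cosh_pos (2 * w)
  constructor
  · have h1 : 2 * w - 1 ≤ Real.log (Real.cosh (2 * w)) := by
      rw [Real.le_log_iff_exp_le hc, Real.cosh_eq, Real.exp_sub]
      have h2 : (2 : ℝ) ≤ Real.exp 1 := by linarith [Real.add_one_le_exp (1 : ℝ)]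
      have h3 := div_le_div_of_nonneg_left (Real.exp_pos (2 * w)).le two_pos h2
      linarith [Real.exp_pos (-(2 * w))]
    linarith
  · have h1 : Real.log (Real.cosh (2 * w)) ≤ 2 * w := by
      rw [Real.log_le_iff_le_exp hc, Real.cosh_eq]
      have := Real.exp_le_exp.2 (show -(2 * w) ≤ 2 * w by linarith)
      linarith
    linarith

theorem exists_approximatesParity :
    ∃ p : Polynomial ℝ, ∀ m : ℕ, ∀ S ∈ labelledSets m,
      ∃ R : RBM (Fin (m + 1)) (Fin (S.card ^ 2 + 1)), ∃ C : ℝ,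
        1 ≤ C ∧ C ≤ p.eval ((m + 1 : ℕ) : ℝ) ∧ ApproximatesParity R S C ∧
        R.lambdaTwo ≤ p.eval ((m + 1 : ℕ) : ℝ) ∧
        R.topNorm (Fin.last m) ≤ p.eval ((m + 1 : ℕ) : ℝ) := by
  refine ⟨3 * Polynomial.X ^ 2 + 3 * Polynomial.X + 1, fun m S _ => ?_⟩
  have heval : (3 * Polynomial.X ^ 2 + 3 * Polynomial.X + 1 : Polynomial ℝ).eval
      ((m + 1 : ℕ) : ℝ) = 3 * ((m + 1 : ℕ) : ℝ) ^ 2 + 3 * ((m + 1 : ℕ) : ℝ) + 1 := by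
    simp
  rw [heval]
  have hS : (#S : ℝ) ≤ ((m + 1 : ℕ) : ℝ) := by
    exact_mod_cast (Finset.card_le_univ S).trans_eq (Fintype.card_fin _)
  have hn1 : (1 : ℝ) ≤ ((m + 1 : ℕ) : ℝ) := by exact_mod_cast Nat.le_add_left 1 m
  set n : ℝ := ((m + 1 : ℕ) : ℝ) with hn
  -- The pair weight `w = n + 1` is fixed first and `C` is read off from it. This gives `n ≤ C ≤ w`:
  -- the lower bound serves the accuracy, the upper one the weights.
  set C := Real.log (Real.cosh (2 * (n + 1))) / 2 with hC
  obtain ⟨h1, h2⟩ := half_log_cosh_bounds (w := n + 1) (by linarith)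
  rw [← hC, add_sub_cancel_right] at h1
  rw [← hC] at h2
  refine ⟨parityRBM S C (n + 1), C, hn1.trans h1, by nlinarith,
    approximatesParity_parityRBM h1 (by rw [hC]; ring), ?_, ?_⟩
  · refine (lambdaTwo_parityRBM_le S (by linarith) h2).trans ?_
    rw [Fintype.card_fin, ← hn]
    nlinarith
  · refine (RBM.topNorm_le_card _ _).trans ?_
    rw [Fintype.card_fin]
    push_cast
    nlinarith [pow_le_pow_left₀ (Nat.cast_nonneg #S) hS 2]

theorem mainTheorem8 :
    -- RBMs realising the parities exist, with all parameters polynomial in `n = m + 1`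
    (∃ p : Polynomial ℝ, ∀ m : ℕ, ∀ S ∈ labelledSets m,
      ∃ R : RBM (Fin (m + 1)) (Fin (S.card ^ 2 + 1)), ∃ C : ℝ,
        1 ≤ C ∧ C ≤ p.eval ((m + 1 : ℕ) : ℝ) ∧ ApproximatesParity R S C ∧
        R.lambdaTwo ≤ p.eval ((m + 1 : ℕ) : ℝ) ∧
        R.topNorm (Fin.last m) ≤ p.eval ((m + 1 : ℕ) : ℝ)) ∧
    -- the class of all parities on `[n - 1]`
    (∀ p : Polynomial ℝ, ∃ ε : ℝ, 0 < ε ∧ ∀ α : ℝ, 0 < α → ∃ n₀ : ℕ, ∀ m : ℕ, n₀ ≤ m + 1 →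
      ∀ (R : RBMFamily m) (L : ℝ),
        AdmissibleFamily (labelledSets m) R (p.eval ((m + 1 : ℕ) : ℝ)) L →
        ¬ SQLearnable (labelledSets m) R
          (((m + 1 : ℕ) : ℝ) ^ (-(L ^ ε))) ⌊((m + 1 : ℕ) : ℝ) ^ (L ^ ε)⌋₊ (1 / 4) α) ∧
    -- the parities with `|S| = k` known, where `k` and `n - k` are at least a power of `n`
    (∀ (p : Polynomial ℝ) (δ : ℝ), 0 < δ →
      ∃ ε : ℝ, 0 < ε ∧ ∀ α : ℝ, 0 < α → ∃ n₀ : ℕ, ∀ m : ℕ, n₀ ≤ m + 1 →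
      ∀ k : ℕ, ((m + 1 : ℕ) : ℝ) ^ δ ≤ (k : ℝ) →
        (k : ℝ) ≤ ((m + 1 : ℕ) : ℝ) - ((m + 1 : ℕ) : ℝ) ^ δ →
      ∀ (R : RBMFamily m) (L : ℝ),
        AdmissibleFamily (labelledSetsOfCard m k) R (p.eval ((m + 1 : ℕ) : ℝ)) L →
        ¬ SQLearnable (labelledSetsOfCard m k) R
          (((m + 1 : ℕ) : ℝ) ^ (-(L ^ ε))) ⌊((m + 1 : ℕ) : ℝ) ^ (L ^ ε)⌋₊ (1 / 4) α) :=
  ⟨exists_approximatesParity, not_sqLearnable_labelledSets, not_sqLearnable_labelledSetsOfCard⟩
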